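/- Let $\mathcal{C}^\infty$ be the real vector space of infinitely differentiable functions $f:\mathbb{R}\to\mathbb{R}$, endowed with the Fréchet topology of uniform convergence on compact sets of functions and of all their derivatives. Let $\mathcal{PS}\subset\mathcal{C}^\infty$ be the set of Pringsheim-singular functions, i.e. of those $f\in\mathcal{C}^\infty$ whose Taylor series at $x_0$ has radius of convergence $0$ for every $x_0\in\mathbb{R}$. For $Z\subset\mathbb{R}$, let $\mathcal{PS}_Z$ be the set of those $f\in\mathcal{PS}$ with $f(x)=0$ for all $x\in Z$. A function $\varphi \in \mathcal{C}^\infty$ is entire if there is $x_0\in\mathbb{R}$ with $\varphi(x)=\sum_{n\ge 0}\frac{\varphi^{(n)}(x_0)}{n!}(x-x_0)^n$ for all $x\in\mathbb{R}$; let $\mathcal{E}$ be the set of entire functions. A subset $A$ of a vector space $X$ is $\alpha$-lineable ($\alpha$ a cardinal) if there is a vector subspace $M\subset X$ with $\dim M=\alpha$ and $M\setminus\{0\}\subset A$, and maximal lineable in $X$ if it is $\dim(X)$-lineable; if $X$ is a topological vector space, $A$ is maximal dense-lineable in $X$ if there is a dense vector subspace $M$ of $X$ with $\dim M=\dim X$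 and $M\setminus\{0\}\subset A$. Then $\dim \mathcal{C}^\infty=\mathfrak{c}$, the cardinality of the continuum, and the following hold. (a) If $Z\subset\mathbb{R}$ has no accumulation point in $\mathbb{R}$, then $\mathcal{PS}_Z$ is maximal lineable in $\mathcal{C}^\infty$, i.e. $\mathfrak{c}$-lineable. (b) $\mathcal{PS}$ is maximal dense-lineable in $\mathcal{C}^\infty$. Moreover, there is a function $f\in\mathcal{PS}$ without zeros such that $f\cdot\mathcal{E}=\{f\varphi:\varphi\in\mathcal{E}\}$ is a dense vector subspace of $\mathcal{C}^\infty$ with $\dim (f\cdot\mathcal{E})=\dim\mathcal{C}^\infty$ and $(f\cdot\mathcal{E})\setminus\{0\}\subset\mathcal{PS}$. -/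

import Mathlib

open scoped Cardinal ContDiff Nat Topology

noncomputable section

/-! ### Lineability notions -/

universe u v

/-- A subset `A` of a `K`-vector space `X` is `α`-lineable if some vector subspace `M` of `X` of
dimension `α` satisfies `M \ {0} ⊆ A`. -/
def IsLineable (K : Type v) {X : Type u} [Field K] [AddCommGroup X] [Module K X]
    (α : Cardinal.{u}) (A : Set X) : Prop :=
  ∃ M : Submodule K X, Module.rank K M = α ∧ (M : Set X) \ {0} ⊆ A

/-- `A` is maximal lineable in `X` if it is `dim X`-lineable. -/
def IsMaximalLineable (K : Type v) {X : Type u} [Field K] [AddCommGroup X] [Module K X]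
    (A : Set X) : Prop :=
  IsLineable K (Module.rank K X) A

/-- The subspace `M` of the topological vector space `X` is a witness of maximal
dense-lineability of `A`: it is dense, has dimension `dim X`, and satisfies `M \ {0} ⊆ A`. -/
def WitnessesMaximalDenseLineable {K : Type v} {X : Type u} [Field K] [AddCommGroup X]
    [Module K X] [TopologicalSpace X] (M : Submodule K X) (A : Set X) : Prop :=
  Dense (M : Set X) ∧ Module.rank K M = Module.rank K X ∧ (M : Set X) \ {0} ⊆ A

/-- `A` is maximal dense-lineable in the topological vector space `X`. -/
def IsMaximalDenseLineable (K : Type v) {X : Type u} [Field K] [AddCommGroup X] [Module K X]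
    [TopologicalSpace X] (A : Set X) : Prop :=
  ∃ M : Submodule K X, WitnessesMaximalDenseLineable M A

/-! ### The space of smooth functions on the real line -/

/-- The infinitely differentiable functions, as a subalgebra of all functions `ℝ → ℝ`. -/
def smoothSubalgebra : Subalgebra ℝ (ℝ → ℝ) where
  carrier := {f | ContDiff ℝ ∞ f}
  mul_mem' hf hg := ContDiff.mul (show ContDiff ℝ ∞ _ from hf) (show ContDiff ℝ ∞ _ from hg)
  add_mem' hf hg := ContDiff.add (show ContDiff ℝ ∞ _ from hf) (show ContDiff ℝ ∞ _ from hg)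
  algebraMap_mem' c := (contDiff_const : ContDiff ℝ ∞ fun _ : ℝ => c)

/-- The algebra of infinitely differentiable functions `ℝ → ℝ` (with pointwise operations). It is
a type of its own, so that it carries the topology below and not that of pointwise convergence. -/
def SmoothFun : Type := smoothSubalgebra

namespace SmoothFun

instance : CommRing SmoothFun := inferInstanceAs (CommRing smoothSubalgebra)

instance : Algebra ℝ SmoothFun := inferInstanceAs (Algebra ℝ smoothSubalgebra)

instance : CoeFun SmoothFun (fun _ => ℝ → ℝ) := ⟨fun f => Subtype.val f⟩

theorem contDiff (f : SmoothFun) : ContDiff ℝ ∞ (f : ℝ → ℝ) := f.2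

/-- The `n`-th derivative, as a linear map from smooth functions to continuous functions. -/
def derivCM (n : ℕ) : SmoothFun →ₗ[ℝ] C(ℝ, ℝ) where
  toFun f := ⟨iteratedDeriv n f,
    f.contDiff.continuous_iteratedDeriv n (by exact_mod_cast le_top)⟩
  map_add' f g := by
    ext x
    exact iteratedDeriv_fun_add
      (f.contDiff.contDiffAt.of_le (by exact_mod_cast le_top))
      (g.contDiff.contDiffAt.of_le (by exact_mod_cast le_top))
  map_smul' c f := by
    ext x
    exact iteratedDeriv_const_smul_field c (f : ℝ → ℝ)

/-- The Fréchet topology: uniform convergence on compact sets of the function and of all its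
derivatives (`C(ℝ, ℝ)` carries the topology of uniform convergence on compact sets). -/
instance : TopologicalSpace SmoothFun :=
  ⨅ n : ℕ, TopologicalSpace.induced (derivCM n) inferInstance

instance : IsTopologicalAddGroup SmoothFun :=
  topologicalAddGroup_iInf fun n => topologicalAddGroup_induced (derivCM n)

instance : ContinuousSMul ℝ SmoothFun :=
  continuousSMul_iInf fun n => continuousSMul_induced (derivCM n)

/-- The zero set of a smooth function. -/
def zeroSet (f : SmoothFun) : Set ℝ := {x | f x = 0}

/-- The Taylor series of `f` at `x₀`, i.e. `∑ f⁽ⁿ⁾(x₀) / n! • yⁿ` with `y = x - x₀`. -/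
def taylorAt (f : SmoothFun) (x₀ : ℝ) : FormalMultilinearSeries ℝ ℝ ℝ :=
  FormalMultilinearSeries.ofScalars ℝ fun n : ℕ => iteratedDeriv n f x₀ / n !

/-- `x₀` is a Pringsheim singularity of `f`: the Taylor series there has radius of
convergence zero. -/
def IsPringsheimSingularity (f : SmoothFun) (x₀ : ℝ) : Prop :=
  (f.taylorAt x₀).radius = 0

/-- The Pringsheim-singular functions: every point is a Pringsheim singularity. -/
def pringsheimSingular : Set SmoothFun := {f | ∀ x₀ : ℝ, f.IsPringsheimSingularity x₀}

/-- The Pringsheim-singular functions that vanish on `Z`. -/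
def pringsheimSingularOn (Z : Set ℝ) : Set SmoothFun :=
  {f | f ∈ pringsheimSingular ∧ Z ⊆ f.zeroSet}

/-- The entire functions: those given on all of `ℝ` by their Taylor series at some point. -/
def entire : Set SmoothFun :=
  {g | ∃ x₀ : ℝ, ∀ x : ℝ,
    HasSum (fun n : ℕ => iteratedDeriv n g x₀ / n ! * (x - x₀) ^ n) (g x)}

end SmoothFun

end

/-!
Multiplication by a nonzero analytic function preserves Pringsheim singularities: if the Taylor
series of `f * g` and `g` at a point both converge and that of `g` is nonzero, then a recursion for
the coefficients of the quotient bounds the Taylor coefficients of `f` geometrically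
(`HasGeometricBound.of_cauchyProduct`, `SmoothFun.mul_mem_pringsheimSingular`). So for every
Pringsheim-singular `f` all nonzero elements of `f · ℰ` are Pringsheim-singular. As `0` is not
Pringsheim-singular, this also shows that multiplication by `f` is injective on the space `ℰ` of
entire functions, and the dimension of `f · ℰ` is the continuum because the exponentials
`x ↦ exp (a * x)` are linearly independent; a smooth function is determined by its values at the
rationals, so no larger dimension is possible
(`SmoothFun.rank_map_mulLeft_of_mem_pringsheimSingular`, `SmoothFun.rank_eq_continuum`).

It remains to provide suitable `f`.

* A Pringsheim-singular function without zeros is a lacunary cosine series whose frequencies grow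
  so fast that at every point, for each `n`, the term of index `n` dominates the derivative of one
  of two consecutive orders: the cosine gives the even order, the sine the odd one
  (`SmoothFun.lacunarySeries_mem_pringsheimSingular`). If `f` has no zeros, then multiplication by
  `f` is continuous and surjective, so that `f · ℰ` is dense because the polynomials are, by
  the Weierstrass theorem for a high derivative and integration
  (`SmoothFun.dense_image_mul_left_entire`).
* For a set `Z` without accumulation points, multiply that series by a nonzero analytic function
  that vanishes on `Z`, obtained as an infinite product
  (`SmoothFun.exists_analyticOnNhd_subset_zeroSet`).
-/

/-! ### Coefficient sequences of convergent power series -/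

/-- The sequence `a` is bounded by a geometric progression; equivalently, the power series
`∑ aₙ yⁿ` has positive radius of convergence. -/
def HasGeometricBound (a : ℕ → ℝ) : Prop :=
  ∃ K R : ℝ, ∀ n, |a n| ≤ K * R ^ n

theorem HasGeometricBound.exists_one_le {a : ℕ → ℝ} (h : HasGeometricBound a) :
    ∃ K R : ℝ, 1 ≤ K ∧ 1 ≤ R ∧ ∀ n, |a n| ≤ K * R ^ n := by
  obtain ⟨K, R, h⟩ := h
  refine ⟨max 1 |K|, max 1 |R|, le_max_left _ _, le_max_left _ _, fun n => (h n).trans ?_⟩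
  calc K * R ^ n ≤ |K * R ^ n| := le_abs_self _
    _ = |K| * |R| ^ n := by rw [abs_mul, abs_pow]
    _ ≤ max 1 |K| * max 1 |R| ^ n := by
      gcongr <;> exact le_max_right _ _

/-- Discrete Grönwall inequality. -/
theorem le_mul_one_add_pow_of_le_sum {b : ℕ → ℝ} {K : ℝ} (hK : 0 ≤ K)
    (h : ∀ n, b n ≤ K * (1 + ∑ i ∈ Finset.range n, b i)) (n : ℕ) : b n ≤ K * (1 + K) ^ n := by
  have hsum (m : ℕ) : 1 + ∑ i ∈ Finset.range m, b i ≤ (1 + K) ^ m := by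
    induction m with
    | zero => simp
    | succ m ih =>
      rw [Finset.sum_range_succ, pow_succ]
      nlinarith [h m]
  exact (h n).trans (mul_le_mul_of_nonneg_left (hsum n) hK)

/-- If a Cauchy product `b * c` is the coefficient sequence of a convergent power series, and so is
the nonzero sequence `c`, then the same holds for the quotient `b`. -/
theorem HasGeometricBound.of_cauchyProduct {a b c : ℕ → ℝ} (ha : HasGeometricBound a)
    (hc : HasGeometricBound c) (hc0 : c ≠ 0)
    (h : ∀ n, a n = ∑ i ∈ Finset.range (n + 1), b i * c (n - i)) : HasGeometricBound b := by
  classical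
  obtain ⟨Ka, Ra, hKa, hRa, ha⟩ := ha.exists_one_le
  obtain ⟨Kc, Rc, hKc, hRc, hc⟩ := hc.exists_one_le
  set K := max Ka Kc
  set R := max Ra Rc
  have hR : 1 ≤ R := hRa.trans (le_max_left _ _)
  have hK : 1 ≤ K := hKa.trans (le_max_left _ _)
  replace ha (n : ℕ) : |a n| ≤ K * R ^ n :=
    (ha n).trans (by gcongr; exacts [le_max_left _ _, le_max_left _ _])
  replace hc (n : ℕ) : |c n| ≤ K * R ^ n :=
    (hc n).trans (by gcongr; exacts [le_max_right _ _, le_max_right _ _])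
  have hex : ∃ k, c k ≠ 0 := Function.ne_iff.mp hc0
  set k := Nat.find hex
  have hk : 0 < |c k| := abs_pos.mpr (Nat.find_spec hex)
  have hlt (j : ℕ) (hj : j < k) : c j = 0 := not_not.mp (Nat.find_min hex hj)
  -- Comparing coefficients of index `n + k` expresses `b n` through the preceding `b i`.
  have hrec (n : ℕ) : b n * c k = a (n + k) - ∑ i ∈ Finset.range n, b i * c (n + k - i) := by
    have hz : ∑ i ∈ Finset.range (n + k + 1), b i * c (n + k - i) =
        ∑ i ∈ Finset.range (n + 1), b i * c (n + k - i) := by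
      refine (Finset.sum_subset (Finset.range_mono (by omega)) fun i hi hi' => ?_).symm
      simp only [Finset.mem_range] at hi hi'
      rw [hlt _ (by omega), mul_zero]
    rw [h, hz, Finset.sum_range_succ, Nat.add_sub_cancel_left]
    ring
  set C := K * R ^ k / |c k|
  have hC : 0 ≤ C := by positivity
  have hβ (n : ℕ) : |b n| / R ^ n ≤ C * (1 + ∑ i ∈ Finset.range n, |b i| / R ^ i) := by
    have h1 : |b n| * |c k| ≤
        K * R ^ (n + k) + ∑ i ∈ Finset.range n, |b i| * (K * R ^ (n + k - i)) := by
      rw [← abs_mul, hrec]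
      refine (abs_sub _ _).trans (add_le_add (ha _) ((Finset.abs_sum_le_sum_abs _ _).trans ?_))
      refine Finset.sum_le_sum fun i _ => ?_
      rw [abs_mul]
      exact mul_le_mul_of_nonneg_left (hc _) (abs_nonneg _)
    have h2 : K * R ^ (n + k) + ∑ i ∈ Finset.range n, |b i| * (K * R ^ (n + k - i)) =
        K * R ^ k * R ^ n * (1 + ∑ i ∈ Finset.range n, |b i| / R ^ i) := by
      rw [mul_add, Finset.mul_sum]
      congr 1
      · ring
      · refine Finset.sum_congr rfl fun i hi => ?_
        have : n + k - i = k + (n - i) := by have := Finset.mem_range.mp hi; omega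
        have h3 : R ^ n = R ^ (n - i) * R ^ i := by
          rw [← pow_add, Nat.sub_add_cancel (Finset.mem_range.mp hi).le]
        rw [this, h3, pow_add]
        field_simp
    rw [h2] at h1
    rw [div_le_iff₀ (by positivity)]
    calc |b n| ≤ K * R ^ k * R ^ n * (1 + ∑ i ∈ Finset.range n, |b i| / R ^ i) / |c k| :=
          (le_div_iff₀ hk).mpr h1
      _ = _ := by simp only [C]; ring
  refine ⟨C, (1 + C) * R, fun n => ?_⟩
  have := le_mul_one_add_pow_of_le_sum hC hβ n
  rw [div_le_iff₀ (by positivity)] at this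
  rwa [mul_pow, ← mul_assoc]

namespace SmoothFun

/-! ### Taylor coefficients -/

@[simp] theorem coe_add (f g : SmoothFun) : ((f + g : SmoothFun) : ℝ → ℝ) = f + g := rfl

@[simp] theorem coe_mul (f g : SmoothFun) : ((f * g : SmoothFun) : ℝ → ℝ) = f * g := rfl

@[simp] theorem coe_smul (c : ℝ) (f : SmoothFun) : ((c • f : SmoothFun) : ℝ → ℝ) = c • f := rfl

@[simp] theorem coe_zero : ((0 : SmoothFun) : ℝ → ℝ) = 0 := rfl

theorem ext {f g : SmoothFun} (h : ∀ x, f x = g x) : f = g := Subtype.ext (funext h)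

/-- The Taylor coefficients of `f` at `x`. -/
noncomputable def taylorCoeff (f : SmoothFun) (x : ℝ) (n : ℕ) : ℝ := iteratedDeriv n f x / n !

theorem norm_taylorAt (f : SmoothFun) (x : ℝ) (n : ℕ) :
    ‖f.taylorAt x n‖ = |f.taylorCoeff x n| := by
  rw [taylorAt, FormalMultilinearSeries.ofScalars_norm]
  rfl

theorem isPringsheimSingularity_iff (f : SmoothFun) (x : ℝ) :
    f.IsPringsheimSingularity x ↔ ¬ HasGeometricBound (f.taylorCoeff x) := by
  rw [IsPringsheimSingularity, ← not_iff_not, not_not, ← ne_eq, ← pos_iff_ne_zero]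
  constructor
  · intro h
    obtain ⟨r, hr0, hr⟩ := ENNReal.lt_iff_exists_nnreal_btwn.mp h
    have hr0 : (0 : ℝ) < r := by exact_mod_cast hr0
    obtain ⟨C, -, hC⟩ := (f.taylorAt x).norm_mul_pow_le_of_lt_radius hr
    refine ⟨C, (r : ℝ)⁻¹, fun n => ?_⟩
    rw [← norm_taylorAt, inv_pow, ← div_eq_mul_inv, le_div_iff₀ (by positivity)]
    exact hC n
  · intro h
    obtain ⟨K, R, -, hR, h⟩ := h.exists_one_le
    have hR0 : 0 < R := by linarith
    refine lt_of_lt_of_le ?_ ((f.taylorAt x).le_radius_of_bound K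
      (r := ⟨R⁻¹, by positivity⟩) fun n => ?_)
    · have : (0 : ℝ) < R⁻¹ := by positivity
      exact ENNReal.coe_pos.mpr this
    · change _ * R⁻¹ ^ n ≤ K
      rw [norm_taylorAt, inv_pow, ← div_eq_mul_inv, div_le_iff₀ (by positivity)]
      exact h n

theorem contDiffAt (f : SmoothFun) (n : ℕ) (x : ℝ) : ContDiffAt ℝ n (f : ℝ → ℝ) x :=
  f.contDiff.contDiffAt.of_le (by exact_mod_cast le_top)

/-- The Taylor series of a product is the Cauchy product of the Taylor series. -/
theorem taylorCoeff_mul (f g : SmoothFun) (x : ℝ) (n : ℕ) :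
    (f * g).taylorCoeff x n =
      ∑ i ∈ Finset.range (n + 1), f.taylorCoeff x i * g.taylorCoeff x (n - i) := by
  rw [taylorCoeff, coe_mul, iteratedDeriv_mul (f.contDiffAt n x) (g.contDiffAt n x),
    Finset.sum_div]
  refine Finset.sum_congr rfl fun i hi => ?_
  rw [Nat.cast_choose ℝ (Finset.mem_range_succ_iff.mp hi), taylorCoeff, taylorCoeff]
  have := Nat.factorial_ne_zero n
  field_simp

/-- Multiplication by a function that is analytic at `x` with nonzero germ preserves Pringsheim
singularities at `x`. -/
theorem IsPringsheimSingularity.mul_analyticAt {f g : SmoothFun} {x : ℝ}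
    (hf : f.IsPringsheimSingularity x) (hg : AnalyticAt ℝ (g : ℝ → ℝ) x)
    (hg0 : ¬ ∀ᶠ y in 𝓝 x, g y = 0) : (f * g).IsPringsheimSingularity x := by
  have hps : HasFPowerSeriesAt (g : ℝ → ℝ) (g.taylorAt x) x := hg.hasFPowerSeriesAt
  have hc : HasGeometricBound (g.taylorCoeff x) := by
    rw [← not_not (a := HasGeometricBound _), ← isPringsheimSingularity_iff]
    exact hps.radius_pos.ne'
  have hc0 : g.taylorCoeff x ≠ 0 := by
    intro h0
    have : g.taylorAt x = 0 := (FormalMultilinearSeries.ofScalars_series_eq_zero ℝ).mpr h0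
    rw [this] at hps
    exact hg0 hps.eventually_eq_zero
  rw [isPringsheimSingularity_iff] at hf ⊢
  exact fun ha => hf (ha.of_cauchyProduct hc hc0 (taylorCoeff_mul f g x))

theorem mul_mem_pringsheimSingular {f g : SmoothFun} (hf : f ∈ pringsheimSingular)
    (hg : AnalyticOnNhd ℝ (g : ℝ → ℝ) Set.univ) (hg0 : g ≠ 0) : f * g ∈ pringsheimSingular := by
  intro x
  refine (hf x).mul_analyticAt (hg x trivial) fun h => hg0 (ext fun y => ?_)
  exact hg.eqOn_zero_of_preconnected_of_eventuallyEq_zero isPreconnected_univ (Set.mem_univ x) h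
    (Set.mem_univ y)

/-! ### Entire functions -/

/-- A function that is everywhere the sum of a power series centred at `x₀` has a power series
expansion on the whole line. -/
theorem hasFPowerSeriesOnBall_of_hasSum {g : ℝ → ℝ} {c : ℕ → ℝ} {x₀ : ℝ}
    (h : ∀ x, HasSum (fun n => c n * (x - x₀) ^ n) (g x)) :
    HasFPowerSeriesOnBall g (FormalMultilinearSeries.ofScalars ℝ c) x₀ ⊤ where
  r_le := by
    refine le_of_eq (FormalMultilinearSeries.radius_eq_top_of_summable_norm _ fun r => ?_).symm
    have := (h (x₀ + r)).summable.norm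
    simpa [FormalMultilinearSeries.ofScalars_norm, abs_mul] using this
  r_pos := ENNReal.zero_lt_top
  hasSum {y} _ := by
    have := h (x₀ + y)
    rw [add_sub_cancel_left] at this
    simpa only [FormalMultilinearSeries.ofScalars_apply_eq, smul_eq_mul] using this

/-- The centre of the expansion of an entire function can be moved to the origin, so that a
function is entire if and only if it is everywhere the sum of a power series centred at `0`. -/
theorem mem_entire_iff {g : SmoothFun} :
    g ∈ entire ↔ ∃ c : ℕ → ℝ, ∀ x : ℝ, HasSum (fun n => c n * x ^ n) (g x) := by
  constructor
  · rintro ⟨x₀, h⟩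
    have h0 : HasFPowerSeriesOnBall (g : ℝ → ℝ) (g.taylorAt x₀) x₀ ⊤ :=
      hasFPowerSeriesOnBall_of_hasSum h
    have h1 := h0.changeOrigin (y := -x₀) ENNReal.coe_lt_top
    rw [add_neg_cancel, ENNReal.top_sub_coe] at h1
    refine ⟨((g.taylorAt x₀).changeOrigin (-x₀)).coeff, fun x => ?_⟩
    have := h1.hasSum (y := x) (by simp)
    rw [zero_add] at this
    simpa only [FormalMultilinearSeries.apply_eq_pow_smul_coeff, smul_eq_mul,
      mul_comm (x ^ _)] using this
  · rintro ⟨c, h⟩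
    have h1 := hasFPowerSeriesOnBall_of_hasSum (g := g) (c := c) (x₀ := 0) (by simpa using h)
    have h2 := h1.hasFPowerSeriesAt.eq_formalMultilinearSeries h1.analyticAt.hasFPowerSeriesAt
    have h3 := FormalMultilinearSeries.ofScalars_series_injective ℝ ℝ h2
    refine ⟨0, fun x => ?_⟩
    simpa [h3] using h x

theorem analyticOnNhd_of_mem_entire {g : SmoothFun} (hg : g ∈ entire) :
    AnalyticOnNhd ℝ (g : ℝ → ℝ) Set.univ := by
  obtain ⟨x₀, h⟩ := hg
  simpa using (hasFPowerSeriesOnBall_of_hasSum h).analyticOnNhd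

/-- The vector space of entire functions. -/
def entireSubmodule : Submodule ℝ SmoothFun where
  carrier := entire
  zero_mem' := mem_entire_iff.mpr ⟨0, fun x => by simp⟩
  add_mem' hf hg := by
    obtain ⟨c, hc⟩ := mem_entire_iff.mp hf
    obtain ⟨d, hd⟩ := mem_entire_iff.mp hg
    exact mem_entire_iff.mpr ⟨c + d, fun x => by simpa [add_mul] using (hc x).add (hd x)⟩
  smul_mem' a g hg := by
    obtain ⟨c, hc⟩ := mem_entire_iff.mp hg
    exact mem_entire_iff.mpr ⟨a • c, fun x => by simpa [mul_assoc] using (hc x).mul_left a⟩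

/-- A polynomial as a smooth function. -/
noncomputable def ofPolynomial (p : Polynomial ℝ) : SmoothFun :=
  ⟨fun x => p.eval x, by
    change ContDiff ℝ ∞ fun x => p.eval x
    simpa using p.contDiff_aeval (𝕜 := ℝ) ∞⟩

theorem ofPolynomial_mem_entire (p : Polynomial ℝ) : ofPolynomial p ∈ entire := by
  refine mem_entire_iff.mpr ⟨p.coeff, fun x => ?_⟩
  change HasSum _ (p.eval x)
  rw [Polynomial.eval_eq_sum_range]
  refine hasSum_sum_of_ne_finset_zero fun n hn => ?_
  rw [Polynomial.coeff_eq_zero_of_natDegree_lt (by simpa [Nat.lt_succ_iff] using hn), zero_mul]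

/-- The exponential function `x ↦ exp (a * x)`. -/
noncomputable def expFun (a : ℝ) : SmoothFun :=
  ⟨fun x => Real.exp (a * x), by
    change ContDiff ℝ ∞ fun x => Real.exp (a * x)
    fun_prop⟩

theorem expFun_mem_entire (a : ℝ) : expFun a ∈ entire := by
  refine mem_entire_iff.mpr ⟨fun n => a ^ n / n !, fun x => ?_⟩
  have := NormedSpace.expSeries_div_hasSum_exp (a * x)
  rw [← Real.exp_eq_exp_ℝ] at this
  simp only [mul_pow] at this
  change HasSum _ (Real.exp (a * x))
  convert! this using 2
  ring

/-- The exponential functions are characters of the additive group of the reals, hence linearly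
independent. -/
theorem linearIndependent_expFun : LinearIndependent ℝ expFun := by
  let χ (a : ℝ) : Multiplicative ℝ →* ℝ :=
    { toFun x := Real.exp (a * x.toAdd)
      map_one' := by simp
      map_mul' x y := by simp [mul_add, Real.exp_add] }
  have hχ : Function.Injective χ := fun a b h => by
    simpa [χ] using DFunLike.congr_fun h (Multiplicative.ofAdd 1)
  have h := (linearIndependent_monoidHom (Multiplicative ℝ) ℝ).comp χ hχ
  exact LinearIndependent.of_comp smoothSubalgebra.val.toLinearMap h

/-! ### Dimensions -/

/-- A smooth function is determined by its values at the rational points. -/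
theorem mk_le_continuum : #SmoothFun ≤ 𝔠 := by
  have hinj : Function.Injective fun (f : SmoothFun) (q : ℚ) => f q := fun f g h =>
    Subtype.ext (Rat.denseRange_cast.equalizer f.contDiff.continuous g.contDiff.continuous h)
  refine (Cardinal.mk_le_of_injective hinj).trans (le_of_eq ?_)
  simp [Cardinal.mk_real]

/-- If multiplication by `f` is injective on the entire functions, then the space `f · ℰ` is of
dimension continuum. -/
theorem rank_map_mulLeft_entireSubmodule {f : SmoothFun}
    (hf : ∀ g ∈ entire, f * g = 0 → g = 0) :
    Module.rank ℝ (entireSubmodule.map (LinearMap.mulLeft ℝ f)) = 𝔠 := by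
  refine le_antisymm ((Submodule.rank_le _).trans ((rank_le_card ℝ _).trans mk_le_continuum)) ?_
  have h1 : LinearIndependent ℝ fun a => f * expFun a := by
    refine linearIndependent_expFun.map (f := LinearMap.mulLeft ℝ f) ?_
    rw [Submodule.disjoint_def]
    intro g hg hg0
    refine hf g ?_ hg0
    have : Submodule.span ℝ (Set.range expFun) ≤ entireSubmodule :=
      Submodule.span_le.mpr (Set.range_subset_iff.mpr expFun_mem_entire)
    exact this hg
  have h2 : LinearIndependent ℝ fun a => (⟨f * expFun a, expFun a, expFun_mem_entire a, rfl⟩ :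
      entireSubmodule.map (LinearMap.mulLeft ℝ f)) :=
    LinearIndependent.of_comp (Submodule.subtype _) h1
  simpa [Cardinal.mk_real] using h2.cardinal_le_rank

theorem rank_eq_continuum : Module.rank ℝ SmoothFun = 𝔠 := by
  refine le_antisymm ((rank_le_card ℝ _).trans mk_le_continuum) ?_
  simpa [Cardinal.mk_real] using linearIndependent_expFun.cardinal_le_rank

theorem zero_notMem_pringsheimSingular : (0 : SmoothFun) ∉ pringsheimSingular := fun h =>
  (isPringsheimSingularity_iff 0 0).mp (h 0) ⟨0, 0, fun n => by
    simp [taylorCoeff, Pi.zero_def]⟩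

theorem map_mulLeft_entireSubmodule_subset {f : SmoothFun} (hf : f ∈ pringsheimSingular) :
    (entireSubmodule.map (LinearMap.mulLeft ℝ f) : Set SmoothFun) \ {0} ⊆ pringsheimSingular := by
  rintro _ ⟨⟨g, hg, rfl⟩, h0⟩
  exact mul_mem_pringsheimSingular hf (analyticOnNhd_of_mem_entire hg) fun h => h0 (by simp [h])

theorem rank_map_mulLeft_of_mem_pringsheimSingular {f : SmoothFun}
    (hf : f ∈ pringsheimSingular) :
    Module.rank ℝ (entireSubmodule.map (LinearMap.mulLeft ℝ f)) = 𝔠 :=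
  rank_map_mulLeft_entireSubmodule fun g hg hfg => by
    by_contra hg0
    exact zero_notMem_pringsheimSingular
      (hfg ▸ mul_mem_pringsheimSingular hf (analyticOnNhd_of_mem_entire hg) hg0)

end SmoothFun

/-! ### Density -/

theorem Polynomial.exists_derivative_eq (q : Polynomial ℝ) : ∃ p : Polynomial ℝ, p.derivative = q := by
  induction q using Polynomial.induction_on' with
  | add p q hp hq =>
    obtain ⟨p', rfl⟩ := hp
    obtain ⟨q', rfl⟩ := hq
    exact ⟨p' + q', Polynomial.derivative_add⟩
  | monomial n a =>
    refine ⟨Polynomial.monomial (n + 1) (a / (n + 1)), ?_⟩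
    rw [Polynomial.derivative_monomial, Nat.add_sub_cancel]
    congr 1
    push_cast
    field_simp

/-- Weierstrass approximation in `C^N`: approximate the derivative and integrate. -/
theorem exists_polynomial_near_iteratedDeriv (N : ℕ) {g : ℝ → ℝ} (hg : ContDiff ℝ ∞ g) (R : ℝ)
    {ε : ℝ} (hε : 0 < ε) :
    ∃ p : Polynomial ℝ, ∀ i ≤ N, ∀ x ∈ Set.Icc (-R) R,
      |iteratedDeriv i (fun y => p.eval y) x - iteratedDeriv i g x| < ε := by
  induction N generalizing g ε with
  | zero =>
    obtain ⟨p, hp⟩ := exists_polynomial_near_of_continuousOn (-R) R g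
      hg.continuous.continuousOn ε hε
    refine ⟨p, fun i hi x hx => ?_⟩
    obtain rfl : i = 0 := by omega
    simpa using hp x hx
  | succ N ih =>
    have hδ : 0 < ε / (|R| + 1) := by positivity
    have hg' : ContDiff ℝ ∞ (deriv g) := (contDiff_infty_iff_deriv.mp hg).2
    obtain ⟨q, hq⟩ := ih hg' hδ
    obtain ⟨p₀, hp₀⟩ := Polynomial.exists_derivative_eq q
    set p := p₀ + Polynomial.C (g 0 - p₀.eval 0) with hp
    have hpq : deriv (fun y => p.eval y) = fun y => q.eval y := by
      ext y
      rw [Polynomial.deriv, hp]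
      simp [hp₀]
    refine ⟨p, fun i hi x hx => ?_⟩
    have hle : ε / (|R| + 1) ≤ ε :=
      div_le_self hε.le (by linarith [abs_nonneg R])
    cases i with
    | succ i =>
      rw [iteratedDeriv_succ', iteratedDeriv_succ', hpq]
      exact (hq i (by omega) x hx).trans_le hle
    | zero =>
      simp only [iteratedDeriv_zero]
      have hxR : |x| ≤ R := abs_le.mpr hx
      have hR : 0 ≤ R := (abs_nonneg x).trans hxR
      have hgd : Differentiable ℝ g := hg.differentiable (by simp)
      have hmv := (convex_Icc (-R) R).norm_image_sub_le_of_norm_deriv_le (𝕜 := ℝ)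
        (f := fun y => p.eval y - g y) (C := ε / (|R| + 1)) (x := 0) (y := x)
        (fun y _ => (p.differentiable.differentiableAt).sub hgd.differentiableAt)
        (fun y hy => by
          rw [deriv_fun_sub p.differentiable.differentiableAt hgd.differentiableAt, hpq]
          simpa using (hq 0 (Nat.zero_le _) y hy).le)
        ⟨by linarith, hR⟩ hx
      have h0 : p.eval 0 - g 0 = 0 := by simp [hp]
      rw [h0, sub_zero, sub_zero, Real.norm_eq_abs, Real.norm_eq_abs] at hmv
      refine hmv.trans_lt ?_
      rw [div_mul_eq_mul_div, div_lt_iff₀ (by positivity), abs_of_nonneg hR]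
      nlinarith

namespace SmoothFun

theorem tendsto_nhds_iff {ι : Type*} {l : Filter ι} {F : ι → SmoothFun} {g : SmoothFun} :
    Filter.Tendsto F l (𝓝 g) ↔
      ∀ n, Filter.Tendsto (fun i => derivCM n (F i)) l (𝓝 (derivCM n g)) := by
  rw [nhds_iInf, Filter.tendsto_iInf]
  refine forall_congr' fun n => ?_
  rw [nhds_induced, Filter.tendsto_comap_iff]
  rfl

theorem continuous_derivCM (n : ℕ) : Continuous (derivCM n) :=
  continuous_iInf_dom (i := n) continuous_induced_dom

theorem derivCM_mul (n : ℕ) (f g : SmoothFun) :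
    derivCM n (f * g) = ∑ i ∈ Finset.range (n + 1),
      (n.choose i : ℝ) • (derivCM i f * derivCM (n - i) g) := by
  ext x
  rw [ContinuousMap.sum_apply]
  simpa [derivCM, mul_assoc] using iteratedDeriv_mul (f.contDiffAt n x) (g.contDiffAt n x)

theorem continuous_mul_left (f : SmoothFun) : Continuous fun g : SmoothFun => f * g := by
  refine continuous_iInf_rng.mpr fun n => continuous_induced_rng.mpr ?_
  have : (derivCM n ∘ fun g : SmoothFun => f * g) = fun g => ∑ i ∈ Finset.range (n + 1),
      (n.choose i : ℝ) • (derivCM i f * derivCM (n - i) g) := funext (derivCM_mul n f)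
  rw [this]
  exact continuous_finsetSum _ fun i _ =>
    ((continuous_const (y := derivCM i f)).mul (continuous_derivCM (n - i))).const_smul
      (n.choose i : ℝ)

theorem dense_entire : Dense entire := by
  intro g
  choose p hp using fun k : ℕ =>
    exists_polynomial_near_iteratedDeriv k g.contDiff k (Nat.one_div_pos_of_nat (α := ℝ) (n := k))
  refine mem_closure_of_tendsto (f := fun k => ofPolynomial (p k)) (b := Filter.atTop) ?_
    (.of_forall fun k => ofPolynomial_mem_entire (p k))
  rw [tendsto_nhds_iff]
  intro n
  rw [ContinuousMap.tendsto_iff_forall_isCompact_tendstoUniformlyOn]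
  intro K hK
  obtain ⟨R, hR⟩ := hK.isBounded.subset_closedBall 0
  rw [Metric.tendstoUniformlyOn_iff]
  intro ε hε
  filter_upwards [Filter.eventually_ge_atTop n, Filter.eventually_ge_atTop ⌈R⌉₊,
    tendsto_one_div_add_atTop_nhds_zero_nat.eventually_lt_const hε] with k hkn hkR hkε x hx
  rw [dist_comm, Real.dist_eq]
  have hx' : |x| ≤ k := by
    have := hR hx
    rw [mem_closedBall_zero_iff, Real.norm_eq_abs] at this
    exact this.trans (Nat.ceil_le.mp hkR)
  exact (hp k n hkn x (abs_le.mp hx')).trans hkε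

theorem surjective_mul_left {f : SmoothFun} (hf : f.zeroSet = ∅) :
    Function.Surjective fun g : SmoothFun => f * g := by
  have h0 (x : ℝ) : f x ≠ 0 := fun h => (Set.eq_empty_iff_forall_notMem.mp hf) x h
  intro g
  let i : SmoothFun := ⟨fun x => (f x)⁻¹, f.contDiff.inv h0⟩
  exact ⟨i * g, ext fun x => mul_inv_cancel_left₀ (h0 x) (g x)⟩

theorem dense_image_mul_left_entire {f : SmoothFun} (hf : f.zeroSet = ∅) :
    Dense ((fun g : SmoothFun => f * g) '' entire) :=
  (surjective_mul_left hf).denseRange.dense_image (continuous_mul_left f) dense_entire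

/-! ### A Pringsheim-singular function without zeros -/

/-- Frequencies that grow so fast that, in the derivatives of order `m = 2 * n + 2` and
`m = 2 * n + 3` of `lacunarySeries`, the amplitude of the term of index `n` exceeds twice the sum of
the bounds for all other terms and of `m ! * (n + 1) ^ m`. -/
noncomputable def freq (n : ℕ) : ℝ :=
  2 * (∑ k : Fin n, freq k ^ (2 * n + 3) + 2 + (2 * n + 3)! * (n + 1 : ℝ) ^ (2 * n + 3))
decreasing_by exact k.2

theorem freq_eq (n : ℕ) : freq n = 2 * (∑ k ∈ Finset.range n, freq k ^ (2 * n + 3) + 2 +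
    (2 * n + 3)! * (n + 1 : ℝ) ^ (2 * n + 3)) := by
  rw [freq, Fin.sum_univ_eq_sum_range (fun k => freq k ^ (2 * n + 3))]

theorem two_le_freq (n : ℕ) : 2 ≤ freq n := by
  induction n using Nat.strong_induction_on with
  | _ n ih =>
    rw [freq_eq]
    have h1 : 0 ≤ ∑ k ∈ Finset.range n, freq k ^ (2 * n + 3) :=
      Finset.sum_nonneg fun k hk =>
        pow_nonneg (by linarith [ih k (Finset.mem_range.mp hk)]) _
    have h2 : 0 ≤ (2 * n + 3)! * (n + 1 : ℝ) ^ (2 * n + 3) := by positivity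
    linarith

theorem freq_pos (n : ℕ) : 0 < freq n := by linarith [two_le_freq n]

/-- The `k`-th term of `lacunarySeries`. -/
noncomputable def lacunaryTerm (k : ℕ) (x : ℝ) : ℝ :=
  (freq k ^ (2 * k + 1))⁻¹ * Real.cos (freq k * x)

theorem contDiff_lacunaryTerm (k : ℕ) : ContDiff ℝ ∞ (lacunaryTerm k) := by
  unfold lacunaryTerm
  fun_prop

theorem iteratedDeriv_lacunaryTerm (k m : ℕ) (x : ℝ) : iteratedDeriv m (lacunaryTerm k) x =
    freq k ^ m / freq k ^ (2 * k + 1) * iteratedDeriv m Real.cos (freq k * x) := by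
  unfold lacunaryTerm
  rw [iteratedDeriv_const_mul_field, iteratedDeriv_comp_const_mul Real.contDiff_cos]
  ring

theorem abs_iteratedDeriv_lacunaryTerm_le (k m : ℕ) (x : ℝ) :
    |iteratedDeriv m (lacunaryTerm k) x| ≤ freq k ^ m / freq k ^ (2 * k + 1) := by
  have hf := freq_pos k
  rw [iteratedDeriv_lacunaryTerm, abs_mul, abs_of_pos (by positivity)]
  exact mul_le_of_le_one_right (by positivity) (Real.abs_iteratedDeriv_cos_le_one m _)

theorem freq_pow_div_le (k m j : ℕ) (h : m + j ≤ 2 * k + 1) :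
    freq k ^ m / freq k ^ (2 * k + 1) ≤ (1 / 2) ^ j := by
  have hf := freq_pos k
  have h2 := two_le_freq k
  calc freq k ^ m / freq k ^ (2 * k + 1) ≤ freq k ^ m / freq k ^ (m + j) := by
        gcongr
        linarith
    _ = (1 / freq k) ^ j := by rw [pow_add, one_div_pow]; field_simp
    _ ≤ (1 / 2) ^ j := by gcongr

theorem summable_freq_pow_div (m : ℕ) : Summable fun k => freq k ^ m / freq k ^ (2 * k + 1) := by
  refine Summable.of_norm_bounded_eventually_nat summable_geometric_two ?_
  filter_upwards [Filter.eventually_ge_atTop m] with k hk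
  have hf := freq_pos k
  rw [Real.norm_of_nonneg (by positivity)]
  exact freq_pow_div_le k m k (by omega)

theorem norm_iteratedFDeriv_lacunaryTerm_le (m k : ℕ) (x : ℝ) :
    ‖iteratedFDeriv ℝ m (lacunaryTerm k) x‖ ≤ freq k ^ m / freq k ^ (2 * k + 1) := by
  rw [norm_iteratedFDeriv_eq_norm_iteratedDeriv]
  exact abs_iteratedDeriv_lacunaryTerm_le k m x

/-- The lacunary cosine series `2 + ∑ λₖ^(-2k-1) cos (λₖ x)` with frequencies `λₖ = freq k`. -/
noncomputable def lacunarySeries : SmoothFun :=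
  ⟨fun x => 2 + ∑' k, lacunaryTerm k x,
    contDiff_const.add (contDiff_tsum contDiff_lacunaryTerm (fun m _ => summable_freq_pow_div m)
      fun m k x _ => norm_iteratedFDeriv_lacunaryTerm_le m k x)⟩

theorem zeroSet_lacunarySeries : lacunarySeries.zeroSet = ∅ := by
  refine Set.eq_empty_iff_forall_notMem.mpr fun x hx => ?_
  have hx : 2 + ∑' k, lacunaryTerm k x = 0 := hx
  have h := tsum_of_norm_bounded (f := fun k => lacunaryTerm k x) (hasSum_geometric_two' 1)
    fun k => ?_
  · rw [eq_neg_of_add_eq_zero_right hx] at h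
    norm_num at h
  · have h1 := abs_iteratedDeriv_lacunaryTerm_le k 0 x
    rw [iteratedDeriv_zero] at h1
    refine h1.trans ((freq_pow_div_le k 0 (k + 1) (by omega)).trans (le_of_eq ?_))
    rw [pow_succ, one_div_pow]
    ring

theorem iteratedDeriv_lacunarySeries {m : ℕ} (hm : 0 < m) (x : ℝ) :
    iteratedDeriv m lacunarySeries x = ∑' k, iteratedDeriv m (lacunaryTerm k) x := by
  change iteratedDeriv m (fun x => 2 + ∑' k, lacunaryTerm k x) x = _
  rw [iteratedDeriv_const_add hm]
  have hs : Summable fun k => iteratedFDeriv ℝ m (lacunaryTerm k) x :=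
    .of_norm_bounded (summable_freq_pow_div m) fun k => norm_iteratedFDeriv_lacunaryTerm_le m k x
  simp only [iteratedDeriv]
  rw [iteratedFDeriv_tsum_apply (N := ⊤) contDiff_lacunaryTerm
    (fun m _ => summable_freq_pow_div m) (fun m k x _ => norm_iteratedFDeriv_lacunaryTerm_le m k x)
    le_top]
  exact (ContinuousMultilinearMap.apply ℝ (fun _ : Fin m => ℝ) ℝ fun _ => 1).map_tsum hs

/-- If the sine or cosine in the derivative of order `m` of the `n`-th term is not small, that term
dominates the derivative of order `m` of the whole series. -/
theorem le_abs_iteratedDeriv_lacunarySeries {n m : ℕ} {x : ℝ} (hm1 : 2 * n + 2 ≤ m)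
    (hm2 : m ≤ 2 * n + 3) (h : 1 / 2 ≤ |iteratedDeriv m Real.cos (freq n * x)|) :
    m ! * (n + 1 : ℝ) ^ m ≤ |iteratedDeriv m lacunarySeries x| := by
  set u : ℕ → ℝ := fun k => iteratedDeriv m (lacunaryTerm k) x with hu
  have hus : Summable u := .of_norm_bounded (summable_freq_pow_div m) fun k =>
    abs_iteratedDeriv_lacunaryTerm_le k m x
  have hhead : |∑ k ∈ Finset.range n, u k| ≤ ∑ k ∈ Finset.range n, freq k ^ (2 * n + 3) := by
    refine (Finset.abs_sum_le_sum_abs _ _).trans (Finset.sum_le_sum fun k _ => ?_)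
    have h2 : 1 ≤ freq k := by linarith [two_le_freq k]
    calc |u k| ≤ freq k ^ m / freq k ^ (2 * k + 1) := abs_iteratedDeriv_lacunaryTerm_le k m x
      _ ≤ freq k ^ m := div_le_self (by positivity) (one_le_pow₀ h2)
      _ ≤ freq k ^ (2 * n + 3) := pow_le_pow_right₀ h2 hm2
  have htail : |∑' j, u (j + (n + 1))| ≤ 2 :=
    tsum_of_norm_bounded (f := fun j => u (j + (n + 1))) hasSum_geometric_two fun j =>
      (abs_iteratedDeriv_lacunaryTerm_le _ m x).trans (freq_pow_div_le _ m j (by omega))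
  have hmain : freq n / 2 ≤ |u n| := by
    have hf := freq_pos n
    have h1 : freq n ≤ freq n ^ m / freq n ^ (2 * n + 1) := by
      rw [le_div_iff₀ (by positivity), ← pow_succ']
      exact pow_le_pow_right₀ (by linarith [two_le_freq n]) hm1
    rw [hu]
    simp only
    rw [iteratedDeriv_lacunaryTerm, abs_mul, abs_of_pos (by positivity)]
    calc freq n / 2 = freq n * (1 / 2) := by ring
      _ ≤ _ := by gcongr
  have hsum : iteratedDeriv m lacunarySeries x =
      u n + (∑ k ∈ Finset.range n, u k + ∑' j, u (j + (n + 1))) := by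
    rw [iteratedDeriv_lacunarySeries (by omega), ← hus.sum_add_tsum_nat_add (n + 1),
      Finset.sum_range_succ]
    ring
  have hlarge : m ! * (n + 1 : ℝ) ^ m ≤ (2 * n + 3)! * (n + 1 : ℝ) ^ (2 * n + 3) := by
    gcongr
    linarith [n.cast_nonneg (α := ℝ)]
  have h3 := abs_sub_abs_le_abs_sub (u n) (-(∑ k ∈ Finset.range n, u k + ∑' j, u (j + (n + 1))))
  rw [sub_neg_eq_add, ← hsum, abs_neg] at h3
  have h4 := abs_add_le (∑ k ∈ Finset.range n, u k) (∑' j, u (j + (n + 1)))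
  have h5 := freq_eq n
  linarith

theorem lacunarySeries_mem_pringsheimSingular : lacunarySeries ∈ pringsheimSingular := by
  intro x
  rw [isPringsheimSingularity_iff]
  intro hb
  obtain ⟨K, R, hK, hR, hb⟩ := hb.exists_one_le
  obtain ⟨n, hn⟩ := exists_nat_gt (K * R)
  -- The sine and the cosine of `freq n * x` cannot both be small, so one of the derivatives of
  -- order `2 * n + 2` and `2 * n + 3` is dominated by the term of index `n`.
  obtain ⟨m, hm1, hm2, hm⟩ : ∃ m, 2 * n + 2 ≤ m ∧ m ≤ 2 * n + 3 ∧
      1 / 2 ≤ |iteratedDeriv m Real.cos (freq n * x)| := by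
    have hsq := Real.sin_sq_add_cos_sq (freq n * x)
    rw [← sq_abs (Real.sin _), ← sq_abs (Real.cos _)] at hsq
    by_cases hc : 1 / 2 ≤ |Real.cos (freq n * x)|
    · refine ⟨2 * (n + 1), by omega, by omega, ?_⟩
      simpa [abs_mul] using hc
    · refine ⟨2 * (n + 1) + 1, by omega, by omega, ?_⟩
      have hs : 1 / 2 ≤ |Real.sin (freq n * x)| := by
        nlinarith [abs_nonneg (Real.sin (freq n * x)), abs_nonneg (Real.cos (freq n * x))]
      simpa [abs_mul] using hs
  have h1 := le_abs_iteratedDeriv_lacunarySeries hm1 hm2 hm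
  have h2 := hb m
  have hfac : (0 : ℝ) < m ! := by exact_mod_cast m.factorial_pos
  rw [taylorCoeff, abs_div, abs_of_pos hfac, div_le_iff₀ hfac] at h2
  have h3 : (n + 1 : ℝ) ^ m ≤ K * R ^ m := by
    refine le_of_mul_le_mul_left ?_ hfac
    linarith
  have h4 : K * R ^ m ≤ (K * R) ^ m := by
    rw [mul_pow]
    gcongr
    exact le_self_pow₀ hK (by omega)
  have h5 : (K * R) ^ m < (n + 1 : ℝ) ^ m :=
    pow_lt_pow_left₀ (by linarith) (by positivity) (by omega)
  linarith

end SmoothFun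

/-! ### Analytic functions with prescribed zeros -/

theorem finite_inter_closedBall_of_not_accPt {Z : Set ℝ}
    (hZ : ∀ x : ℝ, ¬ AccPt x (Filter.principal Z)) (r : ℝ) :
    (Z ∩ Metric.closedBall 0 r).Finite := by
  by_contra h
  obtain ⟨x, -, hx⟩ := Set.Infinite.exists_accPt_of_subset_isCompact h
    (isCompact_closedBall 0 r) Set.inter_subset_right
  exact hZ x (hx.mono (Filter.principal_mono.mpr Set.inter_subset_left))

theorem countable_of_not_accPt {Z : Set ℝ} (hZ : ∀ x : ℝ, ¬ AccPt x (Filter.principal Z)) :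
    Countable Z := by
  have : DiscreteTopology Z := discreteTopology_of_noAccPts fun x _ => hZ x
  exact TopologicalSpace.separableSpace_iff_countable.mp inferInstance

/-- The Gaussian `exp (-c (w - z)²)` is small on a ball about the origin as soon as its real centre
`z` is far from that ball. -/
theorem norm_exp_neg_mul_sq_le {c z r : ℝ} {w : ℂ} (hc : 0 ≤ c) (hw : ‖w‖ ≤ r)
    (hz : 2 * r + 1 < |z|) : ‖Complex.exp (-(c * (w - z) ^ 2))‖ ≤ Real.exp (-c) := by
  rw [Complex.norm_exp, Real.exp_le_exp]
  have hre : (-(c * (w - z) ^ 2) : ℂ).re = -(c * ((w.re - z) ^ 2 - w.im ^ 2)) := by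
    simp [pow_two]
  have h1 : |w.re| ≤ r := (Complex.abs_re_le_norm w).trans hw
  have h2 : w.im ^ 2 ≤ r ^ 2 := by
    rw [← sq_abs]
    exact pow_le_pow_left₀ (abs_nonneg _) ((Complex.abs_im_le_norm w).trans hw) 2
  have h5 : 0 ≤ r := (norm_nonneg w).trans hw
  have h3 : (r + 1) ^ 2 ≤ (w.re - z) ^ 2 := by
    have h4 := abs_sub_abs_le_abs_sub z w.re
    rw [abs_sub_comm] at h4
    rw [← sq_abs (w.re - z)]
    exact pow_le_pow_left₀ (by linarith) (by linarith) 2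
  rw [hre]
  nlinarith [mul_le_mul_of_nonneg_left (show 1 ≤ (w.re - z) ^ 2 - w.im ^ 2 by nlinarith) hc]

namespace SmoothFun

/-- A set without accumulation points lies in the zero set of a nonzero analytic function, a product
of factors `1 - exp (-c (x - z)²)`; the constants `c > 0` are injective in `z` with values in the
positive integers, which makes the product converge locally uniformly in the complex plane. -/
theorem exists_analyticOnNhd_subset_zeroSet {Z : Set ℝ}
    (hZ : ∀ x : ℝ, ¬ AccPt x (Filter.principal Z)) :
    ∃ h : SmoothFun, AnalyticOnNhd ℝ (h : ℝ → ℝ) Set.univ ∧ h ≠ 0 ∧ Z ⊆ h.zeroSet := by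
  have hcount := countable_of_not_accPt hZ
  obtain ⟨e, he⟩ := exists_injective_nat Z
  let c (z : Z) : ℝ := e z + 1
  have hc (z : Z) : 0 < c z := by positivity
  have hsum : Summable fun z => Real.exp (-c z) := by
    have h1 : Summable fun n : ℕ => Real.exp (-(n + 1 : ℝ)) := by
      exact_mod_cast (summable_nat_add_iff 1).mpr Real.summable_exp_neg_nat
    exact h1.comp_injective he
  -- The product is formed in the complex plane, where locally uniform limits of analytic functions
  -- are analytic; `f` is the restriction of `F` to the real line.
  let F (z : Z) (w : ℂ) : ℂ := -Complex.exp (-(c z * (w - z) ^ 2))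
  have hbound (r : ℝ) : ∀ᶠ z in Filter.cofinite, ∀ w ∈ Metric.closedBall (0 : ℂ) r,
      ‖F z w‖ ≤ Real.exp (-c z) := by
    have hfin : {z : Z | |(z : ℝ)| ≤ 2 * r + 1}.Finite := by
      refine Set.Finite.of_finite_image ((finite_inter_closedBall_of_not_accPt hZ
        (2 * r + 1)).subset ?_) Subtype.val_injective.injOn
      rintro _ ⟨z, hz, rfl⟩
      exact ⟨z.2, by simpa using hz⟩
    filter_upwards [hfin.compl_mem_cofinite] with z hz w hw
    rw [norm_neg]
    exact norm_exp_neg_mul_sq_le (hc z).le (by simpa using hw) (not_le.mp hz)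
  have hprod : HasProdLocallyUniformlyOn (fun z w => 1 + F z w) (fun w => ∏' z, (1 + F z w))
      Set.univ := by
    refine hasProdLocallyUniformlyOn_of_forall_compact isOpen_univ fun K _ hK => ?_
    obtain ⟨r, hr⟩ := hK.isBounded.subset_closedBall 0
    exact hsum.hasProdUniformlyOn_one_add hK
      ((hbound r).mono fun z hz w hw => hz w (hr hw)) fun z => by fun_prop
  have hdiff : Differentiable ℂ fun w => ∏' z, (1 + F z w) := by
    rw [← differentiableOn_univ]
    exact hprod.differentiableOn (.of_forall fun s => by
      simpa [Finset.prod_fn] using DifferentiableOn.finsetProd fun _ _ => by fun_prop) isOpen_univ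
  let f (z : Z) (x : ℝ) : ℝ := -Real.exp (-(c z * (x - z) ^ 2))
  have hFf (z : Z) (x : ℝ) : F z x = f z x := by simp [F, f]
  have hfsum (x : ℝ) : Summable fun z => ‖f z x‖ := by
    refine Summable.of_norm_bounded_eventually hsum ?_
    filter_upwards [hbound |x|] with z hz
    have := hz x (by simp)
    rw [hFf, Complex.norm_real] at this
    rwa [norm_norm]
  have hreal (x : ℝ) : ((∏' z, (1 + f z x) : ℝ) : ℂ) = ∏' z, (1 + F z x) := by
    have := (multipliable_one_add_of_summable (hfsum x)).map_tprod Complex.ofRealHom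
      Complex.continuous_ofReal
    simpa [hFf] using this
  have han : AnalyticOnNhd ℝ (fun x : ℝ => ∏' z, (1 + f z x)) Set.univ := fun x _ => by
    have h1 : AnalyticAt ℝ (fun w : ℂ => ∏' z, (1 + F z w)) x :=
      (hdiff.analyticAt x).restrictScalars
    have h2 : AnalyticAt ℝ (fun x : ℝ => (∏' z, (1 + F z x)).re) x :=
      (Complex.reCLM.analyticAt _).comp
        (h1.comp (f := ((↑) : ℝ → ℂ)) (Complex.ofRealCLM.analyticAt x))
    simpa only [← hreal, Complex.ofReal_re] using h2
  refine ⟨⟨_, show ContDiff ℝ ∞ _ from han.contDiff⟩, han, fun h0 => ?_, fun z hz => ?_⟩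
  · have hne : (Set.univ \ Z).Nonempty := by
      by_contra hne
      have := Set.Countable.mono (Set.sdiff_eq_empty.mp (Set.not_nonempty_iff_eq_empty.mp hne))
        (Set.countable_coe_iff.mp hcount)
      exact Set.not_countable_univ this
    obtain ⟨x, -, hx⟩ := hne
    refine tprod_one_add_ne_zero_of_summable (fun z => ?_) (hfsum x)
      (congrArg (fun g : SmoothFun => g x) h0)
    have hxz : x - z ≠ 0 := sub_ne_zero.mpr fun h => hx (h ▸ z.2)
    have hpos : 0 < c z * (x - z) ^ 2 := mul_pos (hc z) (by positivity)
    have : Real.exp (-(c z * (x - z) ^ 2)) < 1 := by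
      rw [← Real.exp_zero, Real.exp_lt_exp]
      linarith
    simp only [f]
    linarith
  · exact tprod_of_exists_eq_zero ⟨⟨z, hz⟩, by simp [f]⟩

end SmoothFun

/-! ### Lineability of the Pringsheim-singular functions -/

open SmoothFun

theorem mainTheorem4 :
    Module.rank ℝ SmoothFun = 𝔠 ∧
    (∀ Z : Set ℝ, (∀ x : ℝ, ¬ AccPt x (Filter.principal Z)) →
      IsMaximalLineable ℝ (SmoothFun.pringsheimSingularOn Z) ∧
      IsLineable ℝ 𝔠 (SmoothFun.pringsheimSingularOn Z)) ∧
    IsMaximalDenseLineable ℝ SmoothFun.pringsheimSingular ∧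
    ∃ f : SmoothFun, f ∈ SmoothFun.pringsheimSingular ∧ f.zeroSet = ∅ ∧
      ∃ M : Submodule ℝ SmoothFun,
        (M : Set SmoothFun) = (fun g : SmoothFun => f * g) '' SmoothFun.entire ∧
        WitnessesMaximalDenseLineable M SmoothFun.pringsheimSingular := by
  have hw : WitnessesMaximalDenseLineable
      (entireSubmodule.map (LinearMap.mulLeft ℝ lacunarySeries)) pringsheimSingular :=
    ⟨dense_image_mul_left_entire zeroSet_lacunarySeries,
      (rank_map_mulLeft_of_mem_pringsheimSingular lacunarySeries_mem_pringsheimSingular).trans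
        rank_eq_continuum.symm,
      map_mulLeft_entireSubmodule_subset lacunarySeries_mem_pringsheimSingular⟩
  refine ⟨rank_eq_continuum, fun Z hZ => ?_, ⟨_, hw⟩, lacunarySeries,
    lacunarySeries_mem_pringsheimSingular, zeroSet_lacunarySeries, _, rfl, hw⟩
  rw [IsMaximalLineable, rank_eq_continuum, and_self]
  obtain ⟨h, han, h0, hZh⟩ := exists_analyticOnNhd_subset_zeroSet hZ
  have hf := mul_mem_pringsheimSingular lacunarySeries_mem_pringsheimSingular han h0
  refine ⟨_, rank_map_mulLeft_of_mem_pringsheimSingular hf, fun g hg =>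
    ⟨map_mulLeft_entireSubmodule_subset hf hg, fun z hz => ?_⟩⟩
  obtain ⟨⟨p, -, rfl⟩, -⟩ := hg
  have hz0 : h z = 0 := hZh hz
  change lacunarySeries z * h z * p z = 0
  rw [hz0, mul_zero, zero_mul]
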